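/- Theorem (Deep Kernel SKSD). Let $p,q$ be continuously differentiable, everywhere positive probability densities on $\mathbb{R}^D$ with $q(x)\to 0$ as $\|x\|\to\infty$, let $s_p=\nabla\log p$, $s_q=\nabla\log q$, $s_p^r=s_p^Tr$, and let $\mathbb{E}_q$ denote expectation with respect to $q(x)\,dx$. Assume that for every $r\in\mathbb{S}^{D-1}$ the function $(s_p-s_q)^Tr$ is in $L^1(q)$ and in $L^2(q)$. For all $r,g\in\mathbb{S}^{D-1}$ let $k_{rg}:\mathbb{R}\times\mathbb{R}\to\mathbb{R}$ be a $C_0$-universal kernel (a reproducing kernel whose reproducing kernel Hilbert space is contained in $C_0(\mathbb{R})$ and dense there in the uniform norm), such that $k_{rg}(s,t)$ depends measurably on $g$ for all fixed $r,s,t$, $\sup_x k_{rg}(x^Tg,x^Tg)<\infty$, and $k(x,x')=k_{rg}(x^Tg,x'^Tg)$ is in the Stein class of $q$, i.e. $k$ has continuous partial derivatives up to order two and each of the functions $f=k(x,\cdot)$ and $f=k(\cdot,x)$, $x\in\mathbb{R}^D$, is smooth with $\nabla(fq)$ integrable and $\int_{\mathbb{R}^D}\nabla(f q)\,dx=0$.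 Let $\phi:\mathbb{R}^D\to\mathbb{R}^D$ be a smooth ($C^\infty$) injective map, and put $\phi^g(x)=\phi(x)^Tg$ and $C_{r,g,\phi}(x)=r^T\frac{\partial\phi(x)}{\partial x}g=\sum_{i,j}r_i\frac{\partial\phi_j}{\partial x_i}(x)\,g_j$, and, with $a=\phi^g(x)$, $b=\phi^g(y)$, $$h_{p,r,g,\phi}(x,y)=s_p^r(x)k_{rg}(a,b)s_p^r(y)+C_{r,g,\phi}(x)s_p^r(y)\,\partial_a k_{rg}(a,b)+C_{r,g,\phi}(y)s_p^r(x)\,\partial_b k_{rg}(a,b)+C_{r,g,\phi}(x)C_{r,g,\phi}(y)\,\partial_a\partial_b k_{rg}(a,b).$$ Assume $\mathbb{E}_q[h_{p,r,g,\phi}(x,x)]<\infty$ for all $r,g\in\mathbb{S}^{D-1}$. Then for all $r,g\in\mathbb{S}^{D-1}$ the function $h_{p,r,g,\phi}$ is integrable with respect to $q(x)q(x')\,dx\,dx'$, the quantity $D^2_{r,g,\phi}(q,p)=\mathbb{E}_{q(x)q(x')}[h_{p,r,g,\phi}(x,x')]$ is nonnegative, and it is measurable in $g$. For every orthonormal basis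 $O_r$ of $\mathbb{R}^D$, with $p_g$ the uniform distribution on $\mathbb{S}^{D-1}$, the deep kernel sliced kernelized Stein discrepancy $$DSK_o(q,p)=\sum_{r\in O_r}\int_{\mathbb{S}^{D-1}}p_g(g)\,D^2_{r,g,\phi}(q,p)\,dg\in[0,\infty]$$ is $0$ if and only if $p=q$ almost everywhere. -/

import Mathlib

open MeasureTheory Filter Topology
open scoped ENNReal ContDiff ZeroAtInfty

noncomputable section

namespace DeepSKSD

/-- The Euclidean space `ℝ^D`. -/
abbrev Euc (D : ℕ) : Type := EuclideanSpace ℝ (Fin D)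

/-- The unit sphere `S^{D-1}` of `ℝ^D`. -/
abbrev unitSphere (D : ℕ) : Set (Euc D) := Metric.sphere (0 : Euc D) 1

/-- The uniform probability distribution on the unit sphere: the normalised surface measure. -/
def uniformSphere (D : ℕ) : Measure (unitSphere D) :=
  ((volume : Measure (Euc D)).toSphere Set.univ)⁻¹ • (volume : Measure (Euc D)).toSphere

/-- `p` is a continuously differentiable probability density supported on (that is, strictly
positive on) the whole of `ℝ^D`. -/
structure IsC1Density {D : ℕ} (p : Euc D → ℝ) : Prop where
  contDiff : ContDiff ℝ 1 p
  pos : ∀ x, 0 < p x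
  integrable : Integrable p
  integral_eq_one : ∫ x, p x = 1

/-- The probability distribution `q(x) dx` with density `q`. -/
def law {D : ℕ} (q : Euc D → ℝ) : Measure (Euc D) :=
  (volume : Measure (Euc D)).withDensity (fun x => ENNReal.ofReal (q x))

/-- The score function `s_p = ∇ log p`. -/
def score {D : ℕ} (p : Euc D → ℝ) (x : Euc D) : Euc D :=
  gradient (fun y => Real.log (p y)) x

/-- The projected score `s_p^r = s_pᵀ r`. -/
def projScore {D : ℕ} (p : Euc D → ℝ) (r x : Euc D) : ℝ := inner ℝ (score p x) r

/-- `f` belongs to the Stein class of `q`: it is smooth and `∫ ∇ (f q) dx = 0`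
(the integrand being integrable). -/
structure InSteinClass {D : ℕ} (q f : Euc D → ℝ) : Prop where
  smooth : ContDiff ℝ ∞ f
  integrable : Integrable (fun x => gradient (fun y => f y * q y) x)
  integral_eq_zero : ∫ x, gradient (fun y => f y * q y) x = 0

/-- The kernel `K` belongs to the Stein class of `q`: it has continuous second order partial
derivatives, and all its sections are in the Stein class of `q`. -/
structure KernelInSteinClass {D : ℕ} (q : Euc D → ℝ) (K : Euc D → Euc D → ℝ) : Prop where
  contDiff : ContDiff ℝ 2 (Function.uncurry K)
  left : ∀ x, InSteinClass q (fun y => K x y)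
  right : ∀ x, InSteinClass q (fun y => K y x)

/-- `κ` is a (real, scalar) `C₀`-universal kernel on `ℝ`: it is the reproducing kernel of a
Hilbert space `H` of functions on `ℝ` with `H ⊆ C₀(ℝ)`, and `H` is dense in `C₀(ℝ)` for the
uniform norm. -/
def IsC0Universal (κ : ℝ → ℝ → ℝ) : Prop :=
  ∃ (H : Type) (_ : NormedAddCommGroup H) (_ : InnerProductSpace ℝ H) (_ : CompleteSpace H)
    (_ : RKHS ℝ H ℝ ℝ),
    (∀ s t : ℝ, RKHS.kernel H s t 1 = κ s t) ∧
    (∀ f : H, ∃ F : C₀(ℝ, ℝ), ∀ t, F t = f t) ∧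
    Dense {F : C₀(ℝ, ℝ) | ∃ f : H, ∀ t, F t = f t}

/-- The conditions on the kernel `κ = k_{rg}` for one direction `g`: it is `C₀`-universal, the
kernel `(x, x') ↦ κ (xᵀ g, x'ᵀ g)` on `ℝ^D` belongs to the Stein class of `q`, and
`sup_x κ (xᵀ g, xᵀ g) < ∞`. -/
structure KernelAssumption {D : ℕ} (q : Euc D → ℝ) (g : Euc D) (κ : ℝ → ℝ → ℝ) : Prop where
  universal : IsC0Universal κ
  stein : KernelInSteinClass q (fun x x' => κ (inner ℝ x g) (inner ℝ x' g))
  bounded : BddAbove (Set.range (fun x : Euc D => κ (inner ℝ x g) (inner ℝ x g)))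

/-- `φ^g(x) = φ(x)ᵀ g`. -/
def proj {D : ℕ} (φ : Euc D → Euc D) (g x : Euc D) : ℝ := inner ℝ (φ x) g

/-- The correction factor `C_{r,g,φ}(x) = rᵀ (∂φ/∂x) g = ∑ i j, r_i (∂φ_j/∂x_i)(x) g_j`, i.e. the
derivative of `φ^g` at `x` in the direction `r`. -/
def corr {D : ℕ} (r g : Euc D) (φ : Euc D → Euc D) (x : Euc D) : ℝ :=
  inner ℝ (fderiv ℝ φ x r) g

/-- The function `h_{p,r,g,φ}(x, y)` for the kernel `κ = k_{rg}`. -/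
def hDeep {D : ℕ} (p : Euc D → ℝ) (r g : Euc D) (φ : Euc D → Euc D) (κ : ℝ → ℝ → ℝ)
    (x y : Euc D) : ℝ :=
  projScore p r x * κ (proj φ g x) (proj φ g y) * projScore p r y
  + corr r g φ x * projScore p r y * deriv (fun s => κ s (proj φ g y)) (proj φ g x)
  + corr r g φ y * projScore p r x * deriv (fun t => κ (proj φ g x) t) (proj φ g y)
  + corr r g φ x * corr r g φ y *
      deriv (fun s => deriv (fun t => κ s t) (proj φ g y)) (proj φ g x)

/-- `D²_{r,g,φ}(q,p) = E_{q(x) q(x')} [h_{p,r,g,φ}(x, x')]`. -/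
def discSq {D : ℕ} (q p : Euc D → ℝ) (r g : Euc D) (φ : Euc D → Euc D) (κ : ℝ → ℝ → ℝ) : ℝ :=
  ∫ z, hDeep p r g φ κ z.1 z.2 ∂((law q).prod (law q))

/-- The deep kernel sliced kernelized Stein discrepancy
`DSK_o(q,p) = ∑_{r ∈ O_r} ∫_{S^{D-1}} p_g(g) D²_{r,g,φ}(q,p) dg`, with `p_g` uniform, for the
family of kernels `k r g = k_{rg}`. The integrand is nonnegative but the integral over `g` need
not be finite, so that the value lies in `[0, ∞]`. -/
def deepSKSD {D : ℕ} (q p : Euc D → ℝ) (O : OrthonormalBasis (Fin D) ℝ (Euc D))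
    (φ : Euc D → Euc D) (k : Euc D → Euc D → ℝ → ℝ → ℝ) : ℝ≥0∞ :=
  ∑ i, ∫⁻ g : unitSphere D, ENNReal.ofReal (discSq q p (O i) g φ (k (O i) g)) ∂(uniformSphere D)

end DeepSKSD

end

open DeepSKSD

namespace DeepSKSD

/-! Write `κ s t = ⟨Φ s, Φ t⟩` with `Φ` the canonical feature map into the RKHS. Since `κ` is C²,
`Φ` is differentiable (`differentiable_of_contDiff_inner`), and `hDeep` becomes `⟨ξ x, ξ y⟩` with
`ξ` the `steinFeature`. Hence D² = ‖E_q ξ‖² (`discSq_eq_norm_sq`). Integration by parts turns this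
mean into the functional f ↦ E_q[δ f(φ^g)], where δ = (s_p - s_q)ᵀr (`inner_integral_steinFeature`);
for p = q it is zero.

Conversely, if the discrepancy vanishes, then for each r in the basis and almost every g the signed
measure δ q dx annihilates f ∘ φ^g for all f in the RKHS, hence, by density, for all f in C₀(ℝ). So
its positive and negative parts have the same image under φ^g. By a Cramér–Wold argument
(`measure_eq_of_ae_map_inner_eq`) they have the same image under φ, and injectivity of φ makes them
equal, so δ = 0. Scores agreeing along a basis force p = c q, and normalisation gives c = 1. -/

/-! ### Feature maps and their differentiability -/

/-- A feature map `Φ : ℝ → H` realising a `C₀`-universal kernel `κ`. -/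
structure IsC0FeatureMap {H : Type*} [NormedAddCommGroup H] [InnerProductSpace ℝ H]
    (κ : ℝ → ℝ → ℝ) (Φ : ℝ → H) : Prop where
  inner_eq : ∀ s t, inner ℝ (Φ s) (Φ t) = κ s t
  exists_zeroAtInfty : ∀ f : H, ∃ F : C₀(ℝ, ℝ), ∀ t, F t = inner ℝ f (Φ t)
  dense : Dense {F : C₀(ℝ, ℝ) | ∃ f : H, ∀ t, F t = inner ℝ f (Φ t)}

theorem IsC0Universal.exists_featureMap {κ : ℝ → ℝ → ℝ} (h : IsC0Universal κ) :
    ∃ (H : Type) (_ : NormedAddCommGroup H) (_ : InnerProductSpace ℝ H) (_ : CompleteSpace H)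
      (Φ : ℝ → H), IsC0FeatureMap κ Φ := by
  obtain ⟨H, i1, i2, i3, i4, hκ, hC, hd⟩ := h
  refine ⟨H, i1, i2, i3, fun s => RKHS.kerFun H s (1 : ℝ), ?_, ?_, ?_⟩
  · intro s t
    rw [← hκ, RKHS.kerFun_inner, RKHS.kerFun_apply]
    simp
  · intro f
    simpa using hC f
  · simpa using hd

/-- A bound for second-order mixed differences by the oscillation of the mixed derivative. -/
theorem abs_mixed_difference_le {κ κ₁ κ₁₂ : ℝ → ℝ → ℝ}
    (h₁ : ∀ s t, HasDerivAt (fun s => κ s t) (κ₁ s t) s)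
    (h₁₂ : ∀ s t, HasDerivAt (fun t => κ₁ s t) (κ₁₂ s t) t) {S : Set ℝ} (hS : Convex ℝ S)
    {c ε : ℝ} (hε : ∀ s ∈ S, ∀ t ∈ S, |κ₁₂ s t - c| ≤ ε) {a s t : ℝ} (ha : a ∈ S)
    (hs : s ∈ S) (ht : t ∈ S) :
    |κ s t - κ s a - κ a t + κ a a - c * (s - a) * (t - a)| ≤ ε * |t - a| * |s - a| := by
  -- Mean value inequality in the second variable; below it is applied again in the first.
  have key : ∀ x ∈ S, |κ₁ x t - κ₁ x a - c * (t - a)| ≤ ε * |t - a| := by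
    intro x hx
    have := hS.norm_image_sub_le_of_norm_hasDerivWithin_le (f := fun t => κ₁ x t - c * t)
      (f' := fun t => κ₁₂ x t - c) (C := ε) (x := a) (y := t)
      (fun y _ => by
        simpa using ((h₁₂ x y).fun_sub ((hasDerivAt_id y).const_mul c)).hasDerivWithinAt)
      (fun y hy => hε x hx y hy) ha ht
    simp only [Real.norm_eq_abs] at this
    convert this using 2
    ring
  have := hS.norm_image_sub_le_of_norm_hasDerivWithin_le
      (f := fun s => κ s t - κ s a - c * (t - a) * s)
      (f' := fun s => κ₁ s t - κ₁ s a - c * (t - a)) (C := ε * |t - a|) (x := a) (y := s)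
      (fun y _ => by
        simpa using (((h₁ y t).fun_sub (h₁ y a)).fun_sub
          ((hasDerivAt_id y).const_mul (c * (t - a)))).hasDerivWithinAt)
      (fun y hy => key y hy) ha hs
  simp only [Real.norm_eq_abs] at this
  convert this using 2
  ring

/-- A feature map of a twice continuously differentiable kernel is differentiable. -/
theorem differentiable_of_contDiff_inner {H : Type*} [NormedAddCommGroup H]
    [InnerProductSpace ℝ H] [CompleteSpace H] {Φ : ℝ → H}
    (hΦ : ContDiff ℝ 2 (fun z : ℝ × ℝ => (inner ℝ (Φ z.1) (Φ z.2) : ℝ))) :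
    Differentiable ℝ Φ := by
  set κ : ℝ → ℝ → ℝ := fun s t => inner ℝ (Φ s) (Φ t) with hκ
  set κ₁ : ℝ × ℝ → ℝ := fun z => fderiv ℝ (fun z : ℝ × ℝ => κ z.1 z.2) z (1, 0) with hκ₁
  have c₁ : ContDiff ℝ 1 κ₁ := (hΦ.fderiv_right (m := 1) (by norm_num)).clm_apply contDiff_const
  set κ₁₂ : ℝ × ℝ → ℝ := fun z => fderiv ℝ κ₁ z (0, 1) with hκ₁₂
  have c₁₂ : Continuous κ₁₂ := (c₁.continuous_fderiv (by norm_num)).clm_apply continuous_const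
  have h₁ : ∀ s t, HasDerivAt (fun s => κ s t) (κ₁ (s, t)) s := fun s t =>
    HasFDerivAt.comp_hasDerivAt (f := fun s => (s, t)) (l := fun z : ℝ × ℝ => κ z.1 z.2) s
      ((hΦ.differentiable (by norm_num)) (s, t)).hasFDerivAt
      ((hasDerivAt_id s).prodMk (hasDerivAt_const s t))
  have h₁₂ : ∀ s t, HasDerivAt (fun t => κ₁ (s, t)) (κ₁₂ (s, t)) t := fun s t =>
    ((c₁.differentiable (by norm_num)) (s, t)).hasFDerivAt.comp_hasDerivAt t
      ((hasDerivAt_const t s).prodMk (hasDerivAt_id t))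
  intro a
  -- `H` is complete, so it suffices that the difference quotients are Cauchy.
  suffices h : ∃ y, Tendsto (slope Φ a) (𝓝[≠] a) (𝓝 y) by
    obtain ⟨y, hy⟩ := h
    exact (hasDerivAt_iff_tendsto_slope.2 hy).differentiableAt
  rw [← cauchy_map_iff_exists_tendsto, Metric.cauchy_iff]
  refine ⟨inferInstance, fun ε hε => ?_⟩
  -- Expanding ‖slope s - slope t‖² costs four errors of ε²/8 each, a total of ε²/2 < ε².
  obtain ⟨δ, hδ, hball⟩ := Metric.continuousAt_iff.1 (c₁₂.continuousAt (x := (a, a)))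
    (ε ^ 2 / 8) (by positivity)
  have hκε : ∀ s ∈ Metric.ball a δ, ∀ t ∈ Metric.ball a δ,
      |κ₁₂ (s, t) - κ₁₂ (a, a)| ≤ ε ^ 2 / 8 := fun s hs t ht =>
    (hball (x := (s, t)) (by
      rw [Prod.dist_eq]; exact max_lt hs ht)).le
  have hin : ∀ s ∈ Metric.ball a δ \ {a}, ∀ t ∈ Metric.ball a δ \ {a},
      |inner ℝ (slope Φ a s) (slope Φ a t) - κ₁₂ (a, a)| ≤ ε ^ 2 / 8 := by
    rintro s ⟨hs, hsa⟩ t ⟨ht, hta⟩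
    have hs0 : s - a ≠ 0 := sub_ne_zero.2 hsa
    have ht0 : t - a ≠ 0 := sub_ne_zero.2 hta
    have hb := abs_mixed_difference_le (κ := κ) (κ₁ := fun s t => κ₁ (s, t))
      (κ₁₂ := fun s t => κ₁₂ (s, t)) h₁ h₁₂ (convex_ball a δ) hκε
      (Metric.mem_ball_self hδ) hs ht
    -- The inner product of two slopes is a mixed second difference quotient of `κ`, so it tends to
    -- the mixed derivative.
    have : inner ℝ (slope Φ a s) (slope Φ a t) - κ₁₂ (a, a) =
        (κ s t - κ s a - κ a t + κ a a - κ₁₂ (a, a) * (s - a) * (t - a)) /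
          ((t - a) * (s - a)) := by
      simp only [slope_def_module, real_inner_smul_left, real_inner_smul_right, inner_sub_left,
        inner_sub_right, hκ]
      field_simp
      ring
    rw [this, abs_div, abs_mul, div_le_iff₀ (by positivity)]
    linarith
  refine ⟨slope Φ a '' (Metric.ball a δ \ {a}), image_mem_map ?_, ?_⟩
  · exact sdiff_mem_nhdsWithin_compl (Metric.ball_mem_nhds a hδ) _
  · rintro _ ⟨s, hs, rfl⟩ _ ⟨t, ht, rfl⟩
    rw [dist_eq_norm]
    refine lt_of_pow_lt_pow_left₀ 2 hε.le ?_
    rw [norm_sub_sq_real, ← real_inner_self_eq_norm_sq, ← real_inner_self_eq_norm_sq]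
    have e1 := abs_le.1 (hin s hs s hs)
    have e2 := abs_le.1 (hin s hs t ht)
    have e3 := abs_le.1 (hin t ht t ht)
    nlinarith [sq_pos_of_pos hε]

/-! ### The Stein feature -/

section Feature

variable {D : ℕ} {H : Type*} [NormedAddCommGroup H] [InnerProductSpace ℝ H]

/-- The Hilbert-space valued Stein feature
`x ↦ s_p^r(x) Φ(φ^g(x)) + C_{r,g,φ}(x) Φ'(φ^g(x))`. -/
noncomputable def steinFeature (p : Euc D → ℝ) (r g : Euc D) (φ : Euc D → Euc D) (Φ : ℝ → H)
    (x : Euc D) : H :=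
  projScore p r x • Φ (proj φ g x) + corr r g φ x • deriv Φ (proj φ g x)

theorem deriv_inner_left {Φ : ℝ → H} (hd : Differentiable ℝ Φ) (f : H) (s : ℝ) :
    deriv (fun s => (inner ℝ (Φ s) f : ℝ)) s = inner ℝ (deriv Φ s) f := by
  simpa using ((hd s).hasDerivAt.inner ℝ (hasDerivAt_const s f)).deriv

theorem deriv_inner_right {Φ : ℝ → H} (hd : Differentiable ℝ Φ) (f : H) (s : ℝ) :
    deriv (fun s => (inner ℝ f (Φ s) : ℝ)) s = inner ℝ f (deriv Φ s) := by
  simpa using ((hasDerivAt_const s f).inner ℝ (hd s).hasDerivAt).deriv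

theorem hDeep_eq_inner (p : Euc D → ℝ) (r g : Euc D) (φ : Euc D → Euc D) {κ : ℝ → ℝ → ℝ}
    {Φ : ℝ → H} (hκ : ∀ s t, inner ℝ (Φ s) (Φ t) = κ s t) (hd : Differentiable ℝ Φ)
    (x y : Euc D) :
    hDeep p r g φ κ x y = inner ℝ (steinFeature p r g φ Φ x) (steinFeature p r g φ Φ y) := by
  simp only [hDeep, steinFeature, ← hκ, deriv_inner_left hd, deriv_inner_right hd,
    inner_add_left, inner_add_right, real_inner_smul_left, real_inner_smul_right]
  ring

end Feature

/-! ### Scores, projections and the Stein identity -/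

theorem contDiff_proj {D : ℕ} {φ : Euc D → Euc D} (hφ : ContDiff ℝ ∞ φ) (g : Euc D) :
    ContDiff ℝ ∞ (proj φ g) := hφ.inner ℝ contDiff_const

theorem continuous_corr {D : ℕ} {φ : Euc D → Euc D} (hφ : ContDiff ℝ ∞ φ) (r : Euc D) :
    Continuous (fun z : Euc D × Euc D => corr r z.1 φ z.2) := by
  have : Continuous (fderiv ℝ φ) := hφ.continuous_fderiv (by simp)
  unfold corr
  fun_prop

theorem fderiv_proj {D : ℕ} {φ : Euc D → Euc D} (hφ : ContDiff ℝ ∞ φ) (r g x : Euc D) :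
    fderiv ℝ (proj φ g) x r = corr r g φ x := by
  have h := (hφ.differentiable (by simp) x).hasFDerivAt.inner ℝ (hasFDerivAt_const g x)
  simp [show proj φ g = fun x => inner ℝ (φ x) g from rfl, h.fderiv, corr]

theorem IsC1Density.contDiff_log {D : ℕ} {p : Euc D → ℝ} (hp : IsC1Density p) :
    ContDiff ℝ 1 (fun x => Real.log (p x)) := hp.contDiff.log fun x => (hp.pos x).ne'

theorem projScore_eq_fderiv {D : ℕ} (p : Euc D → ℝ) (r x : Euc D) :
    projScore p r x = fderiv ℝ (fun y => Real.log (p y)) x r := by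
  simp [projScore, score, gradient, InnerProductSpace.toDual_symm_apply]

theorem IsC1Density.continuous_projScore {D : ℕ} {p : Euc D → ℝ} (hp : IsC1Density p)
    (r : Euc D) : Continuous (projScore p r) := by
  have := hp.contDiff_log.continuous_fderiv (by norm_num)
  simp only [funext (projScore_eq_fderiv p r)]
  fun_prop

theorem IsC1Density.mul_projScore {D : ℕ} {p : Euc D → ℝ} (hp : IsC1Density p)
    (r x : Euc D) : p x * projScore p r x = fderiv ℝ p x r := by
  have h := ((hp.contDiff.differentiable (by norm_num) x).hasFDerivAt.log (hp.pos x).ne').fderiv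
  have := (hp.pos x).ne'
  rw [projScore_eq_fderiv, h]
  simp
  field_simp

theorem IsC1Density.isProbabilityMeasure_law {D : ℕ} {q : Euc D → ℝ} (hq : IsC1Density q) :
    IsProbabilityMeasure (law q) := by
  refine ⟨?_⟩
  rw [law, withDensity_apply _ MeasurableSet.univ, Measure.restrict_univ,
    ← ofReal_integral_eq_lintegral_ofReal hq.integrable (ae_of_all _ fun x => (hq.pos x).le),
    hq.integral_eq_one, ENNReal.ofReal_one]

theorem IsC1Density.measurable_ofReal {D : ℕ} {q : Euc D → ℝ} (hq : IsC1Density q) :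
    Measurable (fun x => ENNReal.ofReal (q x)) :=
  hq.contDiff.continuous.measurable.ennreal_ofReal

theorem IsC1Density.integral_law {D : ℕ} {q : Euc D → ℝ} (hq : IsC1Density q) (f : Euc D → ℝ) :
    ∫ x, f x ∂(law q) = ∫ x, q x * f x := by
  rw [law, integral_withDensity_eq_integral_toReal_smul hq.measurable_ofReal (by simp)]
  simp [ENNReal.toReal_ofReal (hq.pos _).le]

theorem IsC1Density.integrable_law_iff {D : ℕ} {q : Euc D → ℝ} (hq : IsC1Density q)
    {f : Euc D → ℝ} : Integrable f (law q) ↔ Integrable (fun x => q x * f x) := by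
  rw [law, integrable_withDensity_iff_integrable_smul' hq.measurable_ofReal (by simp)]
  simp [ENNReal.toReal_ofReal (hq.pos _).le]

/-- The integral of an integrable directional derivative of an integrable function vanishes. -/
theorem integral_fderiv_eq_zero {D : ℕ} {F : Euc D → ℝ} {r : Euc D} (hF : Differentiable ℝ F)
    (hi : Integrable F) (hi' : Integrable (fun x => fderiv ℝ F x r)) :
    ∫ x, fderiv ℝ F x r = 0 := by
  -- Integration by parts against the constant 1.
  have := integral_mul_fderiv_eq_neg_fderiv_mul_of_integrable (μ := (volume : Measure (Euc D)))
    (f := F) (g := fun _ => (1 : ℝ)) (v := r) (by simpa using hi') (by simp) (by simpa using hi)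
    (fun x _ => hF x) (fun x _ => differentiableAt_const _)
  simpa [eq_comm] using this

/-- The Stein identity along the direction `r`. -/
theorem IsC1Density.stein_identity {D : ℕ} {q : Euc D → ℝ} (hq : IsC1Density q)
    {φ : Euc D → Euc D} (hφ : ContDiff ℝ ∞ φ) (r g : Euc D) {u : ℝ → ℝ} (hu : Differentiable ℝ u)
    {C : ℝ} (hC : ∀ t, |u t| ≤ C)
    (hi : Integrable (fun x => projScore q r x * u (proj φ g x) +
      corr r g φ x * deriv u (proj φ g x)) (law q)) :
    ∫ x, (projScore q r x * u (proj φ g x) + corr r g φ x * deriv u (proj φ g x)) ∂(law q) = 0 := by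
  have hdp : Differentiable ℝ (proj φ g) := (contDiff_proj hφ g).differentiable (by simp)
  have hdq : Differentiable ℝ q := hq.contDiff.differentiable (by norm_num)
  have hd : ∀ x, fderiv ℝ (fun x => q x * u (proj φ g x)) x r =
      q x * (projScore q r x * u (proj φ g x) + corr r g φ x * deriv u (proj φ g x)) := by
    intro x
    have h2 := (hu (proj φ g x)).hasDerivAt.comp_hasFDerivAt x (hdp x).hasFDerivAt
    have h := ((hdq x).hasFDerivAt.mul h2).fderiv
    have h' : fderiv ℝ (fun x => q x * u (proj φ g x)) x = _ := h
    rw [h', mul_add, ← mul_assoc, hq.mul_projScore, ← fderiv_proj hφ]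
    simp
    ring
  rw [hq.integral_law]
  rw [hq.integrable_law_iff] at hi
  simp only [← hd] at hi ⊢
  refine integral_fderiv_eq_zero (hdq.mul (hu.comp hdp)) ?_ hi
  refine hq.integrable.mul_bdd (c := C) ?_ (ae_of_all _ fun x => hC _)
  exact (hu.continuous.comp hdp.continuous).aestronglyMeasurable

/-- Restricting the kernel on `Euc D` to the line spanned by the unit vector `g` recovers `κ`. -/
theorem KernelAssumption.contDiff_two {D : ℕ} {q : Euc D → ℝ} {g : Euc D}
    {κ : ℝ → ℝ → ℝ} (h : KernelAssumption q g κ) (hg : g ∈ unitSphere D) :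
    ContDiff ℝ 2 (fun z : ℝ × ℝ => κ z.1 z.2) := by
  have := h.stein.contDiff.comp (g := Function.uncurry _) (f := fun z : ℝ × ℝ => (z.1 • g, z.2 • g))
    (by fun_prop)
  simpa [Function.comp_def, Function.uncurry, real_inner_smul_left, mem_sphere_zero_iff_norm.1 hg] using this

theorem KernelAssumption.exists_featureMap {D : ℕ} {q : Euc D → ℝ} {g : Euc D}
    {κ : ℝ → ℝ → ℝ} (h : KernelAssumption q g κ) (hg : g ∈ unitSphere D) :
    ∃ (H : Type) (_ : NormedAddCommGroup H) (_ : InnerProductSpace ℝ H) (_ : CompleteSpace H)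
      (Φ : ℝ → H), IsC0FeatureMap κ Φ ∧ Differentiable ℝ Φ := by
  obtain ⟨H, i1, i2, i3, Φ, hΦ⟩ := h.universal.exists_featureMap
  refine ⟨H, i1, i2, i3, Φ, hΦ, differentiable_of_contDiff_inner ?_⟩
  simpa only [hΦ.inner_eq] using h.contDiff_two hg

/-! ### The discrepancy as a squared norm -/

section Discrepancy

variable {D : ℕ} {H : Type*} [NormedAddCommGroup H] [InnerProductSpace ℝ H]
  {p q : Euc D → ℝ} {r g : Euc D} {φ : Euc D → Euc D} {κ : ℝ → ℝ → ℝ} {Φ : ℝ → H}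

theorem integrable_hDeep_prod (hq : IsC1Density q)
    (hκ : ∀ s t, inner ℝ (Φ s) (Φ t) = κ s t) (hd : Differentiable ℝ Φ)
    (hi : Integrable (steinFeature p r g φ Φ) (law q)) :
    Integrable (fun z : Euc D × Euc D => hDeep p r g φ κ z.1 z.2) ((law q).prod (law q)) := by
  have := hq.isProbabilityMeasure_law
  simp only [hDeep_eq_inner p r g φ hκ hd]
  refine (hi.norm.mul_prod hi.norm).mono' ?_ (ae_of_all _ fun z => norm_inner_le_norm _ _)
  exact hi.aestronglyMeasurable.comp_fst.inner hi.aestronglyMeasurable.comp_snd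

variable [CompleteSpace H]

/-- `H` is not assumed separable and `deriv Φ` is not known to be continuous, so strong
measurability of derivatives is used. -/
theorem stronglyMeasurable_steinFeature (hp : IsC1Density p) (hφ : ContDiff ℝ ∞ φ)
    (hd : Differentiable ℝ Φ) : StronglyMeasurable (steinFeature p r g φ Φ) := by
  have ha : Continuous (proj φ g) := (contDiff_proj hφ g).continuous
  have hc : Continuous (fun x => corr r g φ x) :=
    (continuous_corr hφ r).comp (by fun_prop : Continuous fun x : Euc D => (g, x))
  refine StronglyMeasurable.add ?_ ?_
  · exact ((hp.continuous_projScore r).smul (hd.continuous.comp ha)).stronglyMeasurable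
  · exact hc.stronglyMeasurable.smul
      ((stronglyMeasurable_deriv Φ).comp_measurable ha.measurable)

/-- The diagonal of `hDeep` is the squared norm of the feature, so the feature is in L², hence in L¹
of a probability measure. -/
theorem integrable_steinFeature (hp : IsC1Density p) (hq : IsC1Density q) (hφ : ContDiff ℝ ∞ φ)
    (hκ : ∀ s t, inner ℝ (Φ s) (Φ t) = κ s t) (hd : Differentiable ℝ Φ)
    (hh : Integrable (fun x => hDeep p r g φ κ x x) (law q)) :
    Integrable (steinFeature p r g φ Φ) (law q) := by
  have := hq.isProbabilityMeasure_law
  have hm := (stronglyMeasurable_steinFeature (r := r) (g := g) hp hφ hd).aestronglyMeasurable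
    (μ := law q)
  refine ((memLp_two_iff_integrable_sq_norm hm).2 ?_).integrable (by norm_num)
  simpa only [hDeep_eq_inner p r g φ hκ hd, real_inner_self_eq_norm_sq] using hh

theorem discSq_eq_norm_sq (hq : IsC1Density q)
    (hκ : ∀ s t, inner ℝ (Φ s) (Φ t) = κ s t) (hd : Differentiable ℝ Φ)
    (hi : Integrable (steinFeature p r g φ Φ) (law q)) :
    discSq q p r g φ κ = ‖∫ x, steinFeature p r g φ Φ x ∂(law q)‖ ^ 2 := by
  have := hq.isProbabilityMeasure_law
  rw [discSq, integral_prod _ (integrable_hDeep_prod hq hκ hd hi)]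
  simp only [hDeep_eq_inner p r g φ hκ hd, integral_inner hi]
  simp only [real_inner_comm (∫ x, steinFeature p r g φ Φ x ∂(law q)), integral_inner hi]
  rw [real_inner_self_eq_norm_sq]

/-- The mean Stein feature represents the functional `f ↦ E_q[(s_p - s_q)^r f(φ^g)]`. -/
theorem inner_integral_steinFeature (hq : IsC1Density q) (hφ : ContDiff ℝ ∞ φ)
    (hΦ : IsC0FeatureMap κ Φ) (hd : Differentiable ℝ Φ)
    (hi : Integrable (steinFeature p r g φ Φ) (law q))
    (hδ : Integrable (fun x => projScore p r x - projScore q r x) (law q)) (f : H) :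
    inner ℝ f (∫ x, steinFeature p r g φ Φ x ∂(law q)) =
      ∫ x, (projScore p r x - projScore q r x) * inner ℝ f (Φ (proj φ g x)) ∂(law q) := by
  have ha : Continuous (proj φ g) := (contDiff_proj hφ g).continuous
  obtain ⟨F, hF⟩ := hΦ.exists_zeroAtInfty f
  set u : ℝ → ℝ := fun t => inner ℝ f (Φ t) with hu
  have hud : Differentiable ℝ u := (differentiable_const f).inner ℝ hd
  have huC : ∀ t, |u t| ≤ ‖F.toBCF‖ := fun t => by
    simpa [hF] using F.toBCF.norm_coe_le_norm t
  have hδu : Integrable (fun x => (projScore p r x - projScore q r x) * u (proj φ g x)) (law q) :=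
    hδ.mul_bdd (c := ‖F.toBCF‖) (hud.continuous.comp ha).aestronglyMeasurable
      (ae_of_all _ fun x => huC _)
  have hiu : Integrable (fun x => inner ℝ f (steinFeature p r g φ Φ x)) (law q) :=
    hi.const_inner f
  have hsub : (fun x => projScore q r x * u (proj φ g x) + corr r g φ x * deriv u (proj φ g x)) =
      fun x => inner ℝ f (steinFeature p r g φ Φ x) -
        (projScore p r x - projScore q r x) * u (proj φ g x) := by
    funext x
    simp only [hu, deriv_inner_right hd, steinFeature, inner_add_right, real_inner_smul_right]
    ring
  have hst := hq.stein_identity hφ r g hud huC (by rw [hsub]; exact hiu.sub hδu)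
  rw [hsub, integral_sub hiu hδu, sub_eq_zero, integral_inner hi] at hst
  exact hst

end Discrepancy

/-! ### Measurability in the direction g -/

section Measurability

/-- The derivative is the pointwise limit of jointly measurable difference quotients with step
1/(n+1). -/
theorem measurable_deriv_of_measurable_uncurry {α : Type*} [MeasurableSpace α] {F : α → ℝ → ℝ}
    (hF : Measurable (fun z : α × ℝ => F z.1 z.2)) (hd : ∀ a, Differentiable ℝ (F a)) :
    Measurable (fun z : α × ℝ => deriv (F z.1) z.2) := by
  refine measurable_of_tendsto_metrizable
    (f := fun (n : ℕ) z => (1 / ((n : ℝ) + 1))⁻¹ * (F z.1 (z.2 + 1 / ((n : ℝ) + 1)) - F z.1 z.2))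
    (fun n => ?_) (tendsto_pi_nhds.2 fun z => ?_)
  · have : Measurable (fun z : α × ℝ => F z.1 (z.2 + 1 / ((n : ℝ) + 1))) :=
      hF.comp (measurable_fst.prodMk (measurable_snd.add_const _))
    exact (this.sub hF).const_mul _
  · refine (hd z.1 z.2).hasDerivAt.tendsto_slope_zero.comp
      (tendsto_nhdsWithin_iff.2 ⟨tendsto_one_div_add_atTop_nhds_zero_nat, ?_⟩)
    exact Eventually.of_forall fun n => (Nat.one_div_pos_of_nat (α := ℝ)).ne'

theorem measurable_discSq {D : ℕ} {p q : Euc D → ℝ} (hp : IsC1Density p) (hq : IsC1Density q)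
    {φ : Euc D → Euc D} (hφ : ContDiff ℝ ∞ φ) (r : Euc D) {κ : unitSphere D → ℝ → ℝ → ℝ}
    (hκ : ∀ g : unitSphere D, KernelAssumption q g (κ g))
    (hm : ∀ s t, Measurable (fun g => κ g s t)) :
    Measurable (fun g : unitSphere D => discSq q p r g φ (κ g)) := by
  have := hq.isProbabilityMeasure_law
  -- Carathéodory function: continuous in the two real arguments, measurable in `g`.
  have hκm : Measurable (fun z : unitSphere D × ℝ × ℝ => κ z.1 z.2.1 z.2.2) :=
    (stronglyMeasurable_uncurry_of_continuous_of_stronglyMeasurable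
      (u := fun (z : ℝ × ℝ) (g : unitSphere D) => κ g z.1 z.2)
      (fun g => ((hκ g).contDiff_two g.2).continuous)
      (fun z => (hm z.1 z.2).stronglyMeasurable)).measurable.comp measurable_swap
  have hd : ∀ g : unitSphere D, (∀ t, Differentiable ℝ (fun s => κ g s t)) ∧
      (∀ s, Differentiable ℝ (fun t => κ g s t)) ∧
      ∀ t, Differentiable ℝ (fun s => deriv (fun t => κ g s t) t) := by
    intro g
    obtain ⟨H, _, _, _, Φ, hΦ, hΦd⟩ := (hκ g).exists_featureMap g.2
    simp only [← hΦ.inner_eq, deriv_inner_right hΦd]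
    exact ⟨fun t => hΦd.inner ℝ (differentiable_const _),
      fun s => (differentiable_const _).inner ℝ hΦd,
      fun t => hΦd.inner ℝ (differentiable_const _)⟩
  have h₁ : Measurable (fun z : (unitSphere D × ℝ) × ℝ =>
      deriv (fun s => κ z.1.1 s z.1.2) z.2) :=
    measurable_deriv_of_measurable_uncurry (F := fun (a : unitSphere D × ℝ) s => κ a.1 s a.2)
      (hκm.comp (by fun_prop : Measurable fun z : (unitSphere D × ℝ) × ℝ => (z.1.1, z.2, z.1.2)))
      fun a => (hd a.1).1 a.2
  have h₂ : Measurable (fun z : (unitSphere D × ℝ) × ℝ =>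
      deriv (fun t => κ z.1.1 z.1.2 t) z.2) :=
    measurable_deriv_of_measurable_uncurry (F := fun (a : unitSphere D × ℝ) t => κ a.1 a.2 t)
      (hκm.comp (by fun_prop : Measurable fun z : (unitSphere D × ℝ) × ℝ => (z.1.1, z.1.2, z.2)))
      fun a => (hd a.1).2.1 a.2
  have h₁₂ : Measurable (fun z : (unitSphere D × ℝ) × ℝ =>
      deriv (fun s => deriv (fun t => κ z.1.1 s t) z.1.2) z.2) :=
    measurable_deriv_of_measurable_uncurry
      (F := fun (a : unitSphere D × ℝ) s => deriv (fun t => κ a.1 s t) a.2)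
      (h₂.comp (by fun_prop :
        Measurable fun z : (unitSphere D × ℝ) × ℝ => ((z.1.1, z.2), z.1.2)))
      fun a => (hd a.1).2.2 a.2
  have hφm : Measurable φ := hφ.continuous.measurable
  have ha : Measurable (fun z : unitSphere D × Euc D × Euc D => proj φ z.1 z.2.1) := by
    unfold proj; fun_prop
  have hb : Measurable (fun z : unitSphere D × Euc D × Euc D => proj φ z.1 z.2.2) := by
    unfold proj; fun_prop
  have hca : Measurable (fun z : unitSphere D × Euc D × Euc D => corr r z.1 φ z.2.1) :=
    (continuous_corr hφ r).measurable.comp (by fun_prop :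
      Measurable fun z : unitSphere D × Euc D × Euc D => ((z.1 : Euc D), z.2.1))
  have hcb : Measurable (fun z : unitSphere D × Euc D × Euc D => corr r z.1 φ z.2.2) :=
    (continuous_corr hφ r).measurable.comp (by fun_prop :
      Measurable fun z : unitSphere D × Euc D × Euc D => ((z.1 : Euc D), z.2.2))
  have hs : Measurable (projScore p r) := (hp.continuous_projScore r).measurable
  have hsa : Measurable (fun z : unitSphere D × Euc D × Euc D => projScore p r z.2.1) := by
    fun_prop
  have hsb : Measurable (fun z : unitSphere D × Euc D × Euc D => projScore p r z.2.2) := by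
    fun_prop
  have hfst : Measurable (fun z : unitSphere D × Euc D × Euc D => z.1) := measurable_fst
  have : Measurable (fun z : unitSphere D × Euc D × Euc D =>
      hDeep p r z.1 φ (κ z.1) z.2.1 z.2.2) := by
    unfold hDeep
    exact ((((hsa.mul (hκm.comp (hfst.prodMk (ha.prodMk hb)))).mul hsb).add
      ((hca.mul hsb).mul (h₁.comp ((hfst.prodMk hb).prodMk ha)))).add
      ((hcb.mul hsa).mul (h₂.comp ((hfst.prodMk ha).prodMk hb)))).add
      ((hca.mul hcb).mul (h₁₂.comp ((hfst.prodMk hb).prodMk ha)))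
  exact (this.stronglyMeasurable.integral_prod_right' (ν := (law q).prod (law q))).measurable

end Measurability

/-! ### Measures determined by their projections -/

section Uniqueness

/-- A signed density orthogonal to a dense set of `C₀`-functions of `a` is orthogonal to all
of them. -/
theorem integral_mul_comp_eq_zero_of_dense {X : Type*} [MeasurableSpace X] {μ : Measure X}
    {δ : X → ℝ} (hδ : Integrable δ μ) {a : X → ℝ} (ha : Measurable a) {S : Set C₀(ℝ, ℝ)}
    (hS : Dense S) (h : ∀ F ∈ S, ∫ x, δ x * F (a x) ∂μ = 0) (F : C₀(ℝ, ℝ)) :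
    ∫ x, δ x * F (a x) ∂μ = 0 := by
  have hb : ∀ (F : C₀(ℝ, ℝ)) t, ‖F t‖ ≤ ‖F‖ := fun F t => F.toBCF.norm_coe_le_norm t
  have hi : ∀ F : C₀(ℝ, ℝ), Integrable (fun x => δ x * F (a x)) μ := fun F =>
    hδ.mul_bdd (c := ‖F‖) ((map_continuous F).measurable.comp ha).aestronglyMeasurable
      (ae_of_all _ fun x => hb F _)
  -- Integration against δ is Lipschitz in the uniform norm with constant ∫|δ|, so vanishing passes
  -- to the closure.
  have hT : LipschitzWith (∫ x, |δ x| ∂μ).toNNReal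
      (fun F : C₀(ℝ, ℝ) => ∫ x, δ x * F (a x) ∂μ) := by
    refine LipschitzWith.of_dist_le_mul fun F G => ?_
    rw [Real.coe_toNNReal _ (integral_nonneg fun x => abs_nonneg _), dist_eq_norm, dist_eq_norm,
      ← integral_sub (hi F) (hi G), ← integral_mul_const]
    refine norm_integral_le_of_norm_le (hδ.abs.mul_const _) (ae_of_all _ fun x => ?_)
    rw [← mul_sub, norm_mul, Real.norm_eq_abs]
    exact mul_le_mul_of_nonneg_left (hb (F - G) (a x)) (abs_nonneg _)
  exact congrFun (hT.continuous.ext_on hS continuous_const fun F hF => h F hF) F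

theorem integral_withDensity_ofReal {X : Type*} [MeasurableSpace X] {μ : Measure X}
    {δ : X → ℝ} (hδ : Measurable δ) (f : X → ℝ) :
    ∫ x, f x ∂(μ.withDensity fun x => ENNReal.ofReal (δ x)) = ∫ x, max (δ x) 0 * f x ∂μ := by
  rw [integral_withDensity_eq_integral_toReal_smul hδ.ennreal_ofReal (by simp)]
  simp [ENNReal.toReal_ofReal']

/-- If a signed density is orthogonal to all `C₀`-functions of `a`, then its positive and negative
parts have the same image under `a`. -/
theorem map_withDensity_eq_of_integral_eq_zero {X : Type*} [MeasurableSpace X] {μ : Measure X}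
    {δ : X → ℝ} (hδ : Integrable δ μ) (hδm : Measurable δ) {a : X → ℝ} (ha : Measurable a)
    (h : ∀ F : C₀(ℝ, ℝ), ∫ x, δ x * F (a x) ∂μ = 0) :
    (μ.withDensity fun x => ENNReal.ofReal (δ x)).map a =
      (μ.withDensity fun x => ENNReal.ofReal (-δ x)).map a := by
  have := isFiniteMeasure_withDensity_ofReal hδ.2
  have := isFiniteMeasure_withDensity_ofReal hδ.neg.2
  simp only [Pi.neg_apply] at this
  refine Measure.ext_of_integral_eq_on_compactlySupported fun f => ?_
  have hf : Continuous f := map_continuous f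
  obtain ⟨C, hC⟩ := f.hasCompactSupport.exists_bound_of_continuous hf
  rw [integral_map ha.aemeasurable hf.aestronglyMeasurable,
    integral_map ha.aemeasurable hf.aestronglyMeasurable,
    integral_withDensity_ofReal hδm, integral_withDensity_ofReal (δ := fun x => -δ x) hδm.neg, ← sub_eq_zero]
  have hfa : AEStronglyMeasurable (fun x => f (a x)) μ :=
    (hf.measurable.comp ha).aestronglyMeasurable
  rw [← integral_sub (hδ.pos_part.mul_bdd hfa (ae_of_all _ fun x => hC _))
    (hδ.neg_part.mul_bdd hfa (ae_of_all _ fun x => hC _))]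
  have h0 := h ⟨f.toContinuousMap, f.hasCompactSupport.is_zero_at_infty⟩
  refine (integral_congr_ae (ae_of_all _ fun x => ?_)).trans h0
  have hx : max (δ x) 0 - max (-δ x) 0 = δ x := by
    rcases le_total 0 (δ x) with h | h <;> simp [h]
  simp only [← sub_mul, hx]
  rfl

theorem isOpenPosMeasure_uniformSphere (D : ℕ) : (uniformSphere D).IsOpenPosMeasure :=
  Measure.isOpenPosMeasure_smul _ (ENNReal.inv_ne_zero.2 (measure_ne_top _ _))

theorem continuous_charFun_of_isFiniteMeasure {E : Type*} [NormedAddCommGroup E]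
    [InnerProductSpace ℝ E] [MeasurableSpace E] [BorelSpace E] [SecondCountableTopology E]
    (ν : Measure E) [IsFiniteMeasure ν] : Continuous (charFun ν) := by
  simp only [funext fun t => charFun_apply (μ := ν) t]
  refine continuous_of_dominated (bound := fun _ => 1) (fun t => ?_) (fun t => ?_)
    (integrable_const _) (ae_of_all _ fun x => ?_)
  · exact (by fun_prop : Continuous fun x : E => _).aestronglyMeasurable
  · exact ae_of_all _ fun x => (Complex.norm_exp_ofReal_mul_I _).le
  · fun_prop

/-- Two finite measures with the same image under almost every projection `x ↦ xᵀ g` agree. -/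
theorem measure_eq_of_ae_map_inner_eq {D : ℕ} [Nonempty (Fin D)] {ν₁ ν₂ : Measure (Euc D)}
    [IsFiniteMeasure ν₁] [IsFiniteMeasure ν₂]
    (h : ∀ᵐ g : unitSphere D ∂(uniformSphere D),
      ν₁.map (fun x => (inner ℝ x (g : Euc D) : ℝ)) =
        ν₂.map (fun x => (inner ℝ x (g : Euc D) : ℝ))) : ν₁ = ν₂ := by
  have := isOpenPosMeasure_uniformSphere D
  have hmap : ∀ (ν : Measure (Euc D)) (g : Euc D) (t : ℝ),
      charFun ν (t • g) = charFun (ν.map (fun x => (inner ℝ x g : ℝ))) t := by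
    intro ν g t
    rw [charFun_apply, charFun_apply_real, integral_map (by fun_prop)
      (by fun_prop : Continuous _).aestronglyMeasurable]
    simp [real_inner_smul_right]
  have key : ∀ (t : ℝ) (g : unitSphere D), charFun ν₁ (t • (g : Euc D)) =
      charFun ν₂ (t • (g : Euc D)) := by
    intro t
    have hc : Continuous (fun g : unitSphere D => t • (g : Euc D)) := by fun_prop
    -- The uniform measure charges every open set, so continuity upgrades almost every `g` to every
    -- `g`.
    refine congrFun ((Continuous.ae_eq_iff_eq (μ := uniformSphere D)
      ((continuous_charFun_of_isFiniteMeasure ν₁).comp hc)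
      ((continuous_charFun_of_isFiniteMeasure ν₂).comp hc)).1 ?_)
    filter_upwards [h] with g hg
    simp only [Function.comp_apply, hmap, hg]
  refine Measure.ext_of_charFun (funext fun ξ => ?_)
  rcases eq_or_ne ξ 0 with rfl | hξ
  · obtain ⟨g, hg⟩ := NormedSpace.sphere_nonempty (E := Euc D) (x := 0) (r := 1) |>.2 zero_le_one
    simpa only [zero_smul] using key 0 ⟨g, hg⟩
  · have hξ' : ‖ξ‖ ≠ 0 := norm_ne_zero_iff.2 hξ
    have := key ‖ξ‖ ⟨‖ξ‖⁻¹ • ξ, by simp [norm_smul, hξ']⟩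
    simpa only [smul_smul, mul_inv_cancel₀ hξ', one_smul] using this

theorem MeasurableEmbedding.map_injective {X Y : Type*} [MeasurableSpace X] [MeasurableSpace Y]
    {φ : X → Y} (hφ : MeasurableEmbedding φ) {μ ν : Measure X} (h : μ.map φ = ν.map φ) :
    μ = ν := by
  ext s _
  rw [← Set.preimage_image_eq s hφ.injective, ← hφ.map_apply, ← hφ.map_apply, h]

end Uniqueness

/-! ### From vanishing projections to equal densities -/

theorem IsC1Density.eq_of_ae_law {D : ℕ} {q : Euc D → ℝ} (hq : IsC1Density q) {f : Euc D → ℝ}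
    (hf : Continuous f) (h : ∀ᵐ x ∂(law q), f x = 0) (x : Euc D) : f x = 0 := by
  have h' : f =ᵐ[volume] fun _ => (0 : ℝ) :=
    (withDensity_absolutelyContinuous' hq.measurable_ofReal.aemeasurable
      (ae_of_all _ fun x => by simpa using hq.pos x)).ae_le h
  exact congrFun ((hf.ae_eq_iff_eq _ continuous_const).1 h') x

/-- A continuous density all of whose deep projections in almost every direction vanish is zero. -/
theorem IsC1Density.eq_zero_of_ae_projections {D : ℕ} [Nonempty (Fin D)] {q : Euc D → ℝ}
    (hq : IsC1Density q) {φ : Euc D → Euc D} (hφ : Continuous φ) (hφ_inj : Function.Injective φ)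
    {δ : Euc D → ℝ} (hδc : Continuous δ) (hδ : Integrable δ (law q))
    (h : ∀ᵐ g : unitSphere D ∂(uniformSphere D), ∀ F : C₀(ℝ, ℝ),
      ∫ x, δ x * F (proj φ g x) ∂(law q) = 0) (x : Euc D) : δ x = 0 := by
  have := hq.isProbabilityMeasure_law
  have := isFiniteMeasure_withDensity_ofReal hδ.2
  have := isFiniteMeasure_withDensity_ofReal hδ.neg.2
  simp only [Pi.neg_apply] at this
  have heq : (law q).withDensity (fun x => ENNReal.ofReal (δ x)) =
      (law q).withDensity (fun x => ENNReal.ofReal (-δ x)) := by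
    -- Lusin–Souslin: a continuous injection between Polish spaces is a measurable embedding.
    refine MeasurableEmbedding.map_injective (hφ.measurableEmbedding hφ_inj)
      (measure_eq_of_ae_map_inner_eq ?_)
    filter_upwards [h] with g hg
    rw [Measure.map_map (by fun_prop) hφ.measurable, Measure.map_map (by fun_prop) hφ.measurable]
    exact map_withDensity_eq_of_integral_eq_zero hδ hδc.measurable
      (by fun_prop : Continuous fun x => (inner ℝ (φ x) (g : Euc D) : ℝ)).measurable hg
  replace heq := (withDensity_eq_iff_of_sigmaFinite hδc.measurable.ennreal_ofReal.aemeasurable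
    hδc.measurable.fun_neg.ennreal_ofReal.aemeasurable).1 heq
  refine hq.eq_of_ae_law hδc ?_ x
  filter_upwards [heq] with x hx
  -- The positive and negative parts agree at `x`, and one of them is zero.
  rcases le_total 0 (δ x) with h | h
  · rw [ENNReal.ofReal_of_nonpos (by linarith : -δ x ≤ 0)] at hx
    exact le_antisymm (ENNReal.ofReal_eq_zero.1 hx) h
  · rw [ENNReal.ofReal_of_nonpos h] at hx
    exact le_antisymm h (neg_nonpos.1 (ENNReal.ofReal_eq_zero.1 hx.symm))

/-- Densities whose scores agree along an orthonormal basis are equal. -/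
theorem IsC1Density.eq_of_projScore_eq {D : ℕ} {p q : Euc D → ℝ} (hp : IsC1Density p)
    (hq : IsC1Density q) (O : OrthonormalBasis (Fin D) ℝ (Euc D))
    (h : ∀ i x, projScore p (O i) x = projScore q (O i) x) : p = q := by
  have hdp := hp.contDiff_log.differentiable (by norm_num)
  have hdq := hq.contDiff_log.differentiable (by norm_num)
  have hconst : ∀ x y, Real.log (p x) - Real.log (q x) = Real.log (p y) - Real.log (q y) := by
    refine is_const_of_fderiv_eq_zero (𝕜 := ℝ) (hdp.sub hdq) fun x => ?_
    refine ContinuousLinearMap.coe_injective (O.toBasis.ext fun i => ?_)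
    have := h i x
    rw [projScore_eq_fderiv, projScore_eq_fderiv] at this
    simp [fderiv_fun_sub (hdp x) (hdq x), this]
  have hpq : ∀ x, p x = p 0 / q 0 * q x := by
    intro x
    have := hconst x 0
    rw [← Real.log_div (hp.pos _).ne' (hq.pos _).ne',
      ← Real.log_div (hp.pos _).ne' (hq.pos _).ne'] at this
    rw [← Real.log_injOn_pos (Set.mem_Ioi.2 (div_pos (hp.pos x) (hq.pos x)))
      (Set.mem_Ioi.2 (div_pos (hp.pos 0) (hq.pos 0))) this, div_mul_cancel₀ _ (hq.pos x).ne']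
  have h1 := hp.integral_eq_one
  rw [integral_congr_ae (ae_of_all _ hpq), integral_const_mul, hq.integral_eq_one, mul_one] at h1
  funext x
  rw [hpq, h1, one_mul]

end DeepSKSD

/-! ### The main theorem -/

open DeepSKSD
theorem mainTheorem8 (D : ℕ) (p q : Euc D → ℝ)
    -- continuously differentiable densities supported on `ℝ^D`, with `q` vanishing at infinity
    (hp : IsC1Density p) (hq : IsC1Density q)
    (hq_infty : Tendsto q (cocompact (Euc D)) (𝓝 0))
    -- the projected score difference is in `L¹(q)` and `L²(q)`
    (hscore_L1 : ∀ r ∈ unitSphere D,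
      Integrable (fun x => |inner ℝ (score p x - score q x) r|) (law q))
    (hscore_L2 : ∀ r ∈ unitSphere D,
      Integrable (fun x => (inner ℝ (score p x - score q x) r) ^ 2) (law q))
    -- the family of kernels `k r g = k_{rg}`
    (k : Euc D → Euc D → ℝ → ℝ → ℝ)
    (hk : ∀ r ∈ unitSphere D, ∀ g ∈ unitSphere D, KernelAssumption q g (k r g))
    (hk_meas : ∀ r ∈ unitSphere D, ∀ s t : ℝ,
      Measurable (fun g : unitSphere D => k r g s t))
    -- the smooth injective map
    (φ : Euc D → Euc D) (hφ : ContDiff ℝ ∞ φ) (hφ_inj : Function.Injective φ)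
    (hh : ∀ r ∈ unitSphere D, ∀ g ∈ unitSphere D,
      Integrable (fun x => hDeep p r g φ (k r g) x x) (law q))
    -- the orthonormal basis `O_r`
    (O : OrthonormalBasis (Fin D) ℝ (Euc D)) :
    -- the discrepancy is well defined ...
    (∀ r ∈ unitSphere D,
      (∀ g ∈ unitSphere D,
        Integrable (fun z : Euc D × Euc D => hDeep p r g φ (k r g) z.1 z.2)
          ((law q).prod (law q)) ∧
        0 ≤ discSq q p r g φ (k r g)) ∧
      Measurable (fun g : unitSphere D => discSq q p r g φ (k r g))) ∧
    -- ... and it vanishes exactly when `p = q` almost everywhere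
    (deepSKSD q p O φ k = 0 ↔ p =ᵐ[volume] q) := by
  have hOi : ∀ i, O i ∈ unitSphere D := fun i => by simp
  have hmeas : ∀ r ∈ unitSphere D, Measurable (fun g : unitSphere D => discSq q p r g φ (k r g)) :=
    fun r hr => measurable_discSq hp hq hφ r (fun g => hk r hr g g.2) (hk_meas r hr)
  have hδc : ∀ r, Continuous (fun x => projScore p r x - projScore q r x) := fun r =>
    (hp.continuous_projScore r).sub (hq.continuous_projScore r)
  have hδ : ∀ r ∈ unitSphere D,
      Integrable (fun x => projScore p r x - projScore q r x) (law q) := by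
    intro r hr
    rw [← integrable_norm_iff (hδc r).aestronglyMeasurable]
    simpa only [projScore, ← inner_sub_left, Real.norm_eq_abs] using hscore_L1 r hr
  refine ⟨fun r hr => ⟨fun g hg => ?_, hmeas r hr⟩, fun h0 => ?_, fun hpq => ?_⟩
  · obtain ⟨H, _, _, _, Φ, hΦ, hd⟩ := (hk r hr g hg).exists_featureMap hg
    have hi := integrable_steinFeature hp hq hφ hΦ.inner_eq hd (hh r hr g hg)
    refine ⟨integrable_hDeep_prod hq hΦ.inner_eq hd hi, ?_⟩
    rw [discSq_eq_norm_sq hq hΦ.inner_eq hd hi]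
    positivity
  · rw [hp.eq_of_projScore_eq hq O fun i x => ?_]
    -- The index `i` supplies D > 0; for D = 0 the score condition is vacuous.
    have : Nonempty (Fin D) := ⟨i⟩
    refine sub_eq_zero.1 (hq.eq_zero_of_ae_projections hφ.continuous hφ_inj (hδc (O i))
      (hδ _ (hOi i)) ?_ x)
    have hz := (Finset.sum_eq_zero_iff.1 h0) i (Finset.mem_univ i)
    rw [lintegral_eq_zero_iff (hmeas _ (hOi i)).ennreal_ofReal] at hz
    filter_upwards [hz] with g hg
    obtain ⟨H, _, _, _, Φ, hΦ, hd⟩ := (hk _ (hOi i) g g.2).exists_featureMap g.2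
    have hi := integrable_steinFeature hp hq hφ hΦ.inner_eq hd (hh _ (hOi i) g g.2)
    have hmean : ∫ x, steinFeature p (O i) g φ Φ x ∂(law q) = 0 := by
      have hle := ENNReal.ofReal_eq_zero.1 hg
      rw [discSq_eq_norm_sq hq hΦ.inner_eq hd hi] at hle
      exact norm_eq_zero.1 (pow_eq_zero_iff two_ne_zero |>.1 (le_antisymm hle (by positivity)))
    refine integral_mul_comp_eq_zero_of_dense (hδ _ (hOi i))
      (contDiff_proj hφ _).continuous.measurable hΦ.dense ?_
    rintro F ⟨f, hf⟩
    have := inner_integral_steinFeature hq hφ hΦ hd hi (hδ _ (hOi i)) f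
    rw [hmean, inner_zero_right] at this
    simpa only [hf] using this.symm
  · obtain rfl : p = q := (hp.contDiff.continuous.ae_eq_iff_eq _ hq.contDiff.continuous).1 hpq
    refine Finset.sum_eq_zero fun i _ => ?_
    refine (lintegral_congr fun g => ?_).trans lintegral_zero
    obtain ⟨H, _, _, _, Φ, hΦ, hd⟩ := (hk _ (hOi i) g g.2).exists_featureMap g.2
    have hi := integrable_steinFeature hp hq hφ hΦ.inner_eq hd (hh _ (hOi i) g g.2)
    -- The score difference is now zero, so the mean feature is orthogonal to every `f`.
    have hmean : ∫ x, steinFeature p (O i) g φ Φ x ∂(law p) = 0 :=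
      ext_inner_left ℝ fun f => by
        simp [inner_integral_steinFeature hq hφ hΦ hd hi (hδ _ (hOi i)) f]
    simp [discSq_eq_norm_sq hq hΦ.inner_eq hd hi, hmean]
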